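/- **Setting.** Let $\Omega=\{(x,y)\in\mathbb{R}^2 : x<y\}$, let $\partial\Omega$ be the diagonal and $\overline\Omega=\Omega\cup\partial\Omega$. For a finite set $S\subset\mathbb{R}^m$ and $\varepsilon\in\mathbb{R}$ let $\mathrm{VR}(S,\varepsilon)$ be the Vietoris–Rips complex, whose simplices are the nonempty subsets of $S$ of (Euclidean) diameter less than $\varepsilon$. For a field $\mathbb{k}$ and an integer $k\ge 0$, the persistence diagram of $S$ in homology dimension $k$, regarded as a measure on $\Omega$, is $D[S]=\sum_{x\in\Omega} n_x\delta_x$, where $n_{(s,t)}$ is the multiplicity of the birth–death pair $(s,t)$ in the persistence module $(H_k(\mathrm{VR}(S,\varepsilon);\mathbb{k}))_{\varepsilon\in\mathbb{R}}$; only pairs with finite death time $t$ are counted. For measures $\mu,\nu$ on $\Omega$ and $1\le p<\infty$, let $$\mathrm{OT}_p(\mu,\nu)=\inf_{\Gamma}\Big(\int_{\overline\Omega\times\overline\Omega}\|x-y\|_p^p\,d\Gamma(x,y)\Big)^{1/p},$$ the infimum being over all Radon measures $\Gamma$ on $\overline\Omega\times\overline\Omega$ with $\Gamma(P\times\overline\Omega)=\mu(P)$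 and $\Gamma(\overline\Omega\times Q)=\nu(Q)$ for all Borel sets $P,Q\subseteq\Omega$. **Statement.** Let $\mathcal{X}\subset\mathbb{R}^m$ be a finite set and let $1\le p<\infty$. There is a constant $C(\mathcal{X},p)>0$, depending only on $\mathcal{X}$ and $p$, such that the following holds for every field $\mathbb{k}$, every homology dimension $k\ge0$, every probability measure $\pi$ on $\mathcal{X}$ and all integers $n,B\ge 1$. Let $S_n^{(1)},\dots,S_n^{(B)}$ be independent samples, each consisting of $n$ i.i.d. points of $\mathcal{X}$ with law $\pi$ (that is, each with law $\pi^{\otimes n}$, and viewed as a subset of $\mathcal{X}$ when its diagram is taken). Let $$\bar D=\frac1B\sum_{i=1}^B D[S_n^{(i)}]$$ be the mean persistence measure, and let $D_\mu$ be the expected persistence diagram, i.e. the measure on $\Omega$ with $D_\mu(A)=\mathbb{E}_{S\sim\pi^{\otimes n}}\big[D[S](A)\big]$ for every Borel set $A\subseteq\Omega$. Then $$\mathbb{E}\big[\mathrm{OT}_p^p(\bar D,D_\mu)\big]\le\frac{C(\mathcal{X},p)}{\sqrt B}.$$ -/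

import Mathlib

set_option maxSynthPendingDepth 3

open MeasureTheory ProbabilityTheory
open scoped ENNReal

noncomputable section

/-! ### Simplicial homology with field coefficients -/

section Homology

variable (𝕜 : Type*) [Field 𝕜] {V : Type*}

/-- The `k`-chains of `K`. -/
def simplicialChains (K : PreAbstractSimplicialComplex V) (k : ℕ) : Submodule 𝕜 (Finset V →₀ 𝕜) :=
  Finsupp.supported 𝕜 𝕜 {σ | σ ∈ K.faces ∧ σ.card = k + 1}

lemma simplicialChains_mono {K L : PreAbstractSimplicialComplex V} (h : K ≤ L) (k : ℕ) :
    simplicialChains 𝕜 K k ≤ simplicialChains 𝕜 L k :=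
  Finsupp.supported_mono fun _ hσ => ⟨h hσ.1, hσ.2⟩

variable [LinearOrder V]

/-- The simplicial boundary operator. A simplex is a finite set of vertices, oriented by the order
of the vertices, and the face omitting `v` carries the sign `(-1) ^ #{w ∈ σ | w < v}`. Vertices have
boundary `0` (unreduced homology). -/
def simplicialBoundary : (Finset V →₀ 𝕜) →ₗ[𝕜] (Finset V →₀ 𝕜) :=
  Finsupp.linearCombination 𝕜 fun σ : Finset V =>
    if 2 ≤ σ.card then
      ∑ v ∈ σ, Finsupp.single (σ.erase v) ((-1 : 𝕜) ^ (σ.filter (· < v)).card)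
    else 0

/-- The `k`-cycles of `K`. -/
def simplicialCycles (K : PreAbstractSimplicialComplex V) (k : ℕ) : Submodule 𝕜 (Finset V →₀ 𝕜) :=
  simplicialChains 𝕜 K k ⊓ LinearMap.ker (simplicialBoundary 𝕜)

/-- The `k`-boundaries of `K`. -/
def simplicialBoundaries (K : PreAbstractSimplicialComplex V) (k : ℕ) :
    Submodule 𝕜 (Finset V →₀ 𝕜) :=
  (simplicialChains 𝕜 K (k + 1)).map (simplicialBoundary 𝕜)

/-- The `k`-th simplicial homology of `K` with coefficients in `𝕜`. -/
abbrev SimplicialHomology (K : PreAbstractSimplicialComplex V) (k : ℕ) : Type _ :=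
  simplicialCycles 𝕜 K k ⧸ (simplicialBoundaries 𝕜 K k).submoduleOf (simplicialCycles 𝕜 K k)

lemma simplicialCycles_mono {K L : PreAbstractSimplicialComplex V} (h : K ≤ L) (k : ℕ) :
    simplicialCycles 𝕜 K k ≤ simplicialCycles 𝕜 L k :=
  inf_le_inf_right _ (simplicialChains_mono 𝕜 h k)

/-- The map in homology induced by the inclusion of a subcomplex. -/
def simplicialHomologyMap {K L : PreAbstractSimplicialComplex V} (h : K ≤ L) (k : ℕ) :
    SimplicialHomology 𝕜 K k →ₗ[𝕜] SimplicialHomology 𝕜 L k :=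
  Submodule.mapQ _ _ (Submodule.inclusion (simplicialCycles_mono 𝕜 h k)) fun _ hx =>
    Submodule.map_mono (simplicialChains_mono 𝕜 h (k + 1)) hx

end Homology

/-! ### The Vietoris–Rips filtration and its persistence diagram -/

/-- The Vietoris–Rips complex of `S` at scale `ε`: all nonempty finite subsets of `S` of diameter
less than `ε`. -/
def vietorisRips {V : Type*} [PseudoMetricSpace V] (S : Set V) (ε : ℝ) :
    PreAbstractSimplicialComplex V where
  faces := {σ | σ.Nonempty ∧ (σ : Set V) ⊆ S ∧ Metric.diam (σ : Set V) < ε}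
  isRelLowerSet_faces := fun {_} hσ => ⟨hσ.1, fun _ hτ hne =>
    ⟨hne, (Finset.coe_subset.2 hτ).trans hσ.2.1,
      (Metric.diam_mono (Finset.coe_subset.2 hτ) (Finset.finite_toSet _).isBounded).trans_lt
        hσ.2.2⟩⟩

lemma vietorisRips_mono {V : Type*} [PseudoMetricSpace V] (S : Set V) {ε ε' : ℝ} (h : ε ≤ ε') :
    vietorisRips S ε ≤ vietorisRips S ε' :=
  fun _ hσ => ⟨hσ.1, hσ.2.1, hσ.2.2.trans_le h⟩

/-- The lexicographic order on `ℝ^m`, used only to orient simplices. -/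
abbrev euclideanLex (m : ℕ) : LinearOrder (EuclideanSpace ℝ (Fin m)) :=
  LinearOrder.lift' (fun x => toLex (WithLp.ofLp x))
    (fun _ _ h => WithLp.ofLp_injective 2 (toLex.injective h))

/-- The open half-plane `Ω` above the diagonal. -/
abbrev HalfPlane : Type := {x : ℝ × ℝ // x.1 < x.2}

/-- The closed half-plane: `Ω` together with the diagonal. -/
abbrev ClosedHalfPlane : Type := {x : ℝ × ℝ // x.1 ≤ x.2}

section Diagram

attribute [local instance] euclideanLex

variable (𝕜 : Type*) [Field 𝕜] {m : ℕ} (k : ℕ) (S : Set (EuclideanSpace ℝ (Fin m)))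

/-- For `a ≤ b ≤ t`: the classes in `H_k` at scale `b` whose image at scale `t` comes from a class
at scale `a`. -/
def deadClasses {a b t : ℝ} (hab : a ≤ b) (hbt : b ≤ t) :
    Submodule 𝕜 (SimplicialHomology 𝕜 (vietorisRips S b) k) :=
  (LinearMap.range (simplicialHomologyMap 𝕜 (vietorisRips_mono S (hab.trans hbt)) k)).comap
    (simplicialHomologyMap 𝕜 (vietorisRips_mono S hbt) k)

/-- For `a ≤ b ≤ c ≤ d`: the number of independent `k`-dimensional homology classes of the
Vietoris–Rips filtration of `S` that are born between the scales `a` and `b` and die between the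
scales `c` and `d`. -/
def birthDeathCount {a b c d : ℝ} (hab : a ≤ b) (hbc : b ≤ c) (hcd : c ≤ d) : ℕ :=
  Module.finrank 𝕜 (deadClasses 𝕜 k S hab (hbc.trans hcd) ⧸
    (deadClasses 𝕜 k S hab hbc).submoduleOf (deadClasses 𝕜 k S hab (hbc.trans hcd)))

/-- The multiplicity of the off-diagonal point `x` in the persistence diagram: the smallest
`birthDeathCount` over the rectangles `[a, b] × [c, d]` around `x`. -/
def diagramMultiplicity (x : HalfPlane) : ℕ :=
  sInf {r | ∃ (a b c d : ℝ) (hab : a ≤ b) (hbc : b ≤ c) (hcd : c ≤ d),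
    a < x.1.1 ∧ x.1.1 < b ∧ c < x.1.2 ∧ x.1.2 < d ∧ r = birthDeathCount 𝕜 k S hab hbc hcd}

/-- The persistence diagram `D[S]` of the Vietoris–Rips filtration of `S` in homology dimension `k`,
as the measure `∑ n_x δ_x` on `Ω`. -/
def persistenceDiagram : Measure HalfPlane :=
  Measure.sum fun x : HalfPlane => (diagramMultiplicity 𝕜 k S x : ℝ≥0∞) • Measure.dirac x

end Diagram

/-! ### Optimal partial transport -/

/-- `Γ` is an admissible transport plan between `μ` and `ν`: a Radon measure on pairs of points of
the closed half-plane whose marginals agree with `μ` and `ν` off the diagonal. -/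
structure IsAdmissiblePlan (μ ν : Measure HalfPlane)
    (Γ : Measure (ClosedHalfPlane × ClosedHalfPlane)) : Prop where
  radon : Γ.Regular
  fst_eq : ∀ P : Set HalfPlane, MeasurableSet P →
    Γ {z | ∃ x ∈ P, z.1.1 = x.1} = μ P
  snd_eq : ∀ Q : Set HalfPlane, MeasurableSet Q →
    Γ {z | ∃ y ∈ Q, z.2.1 = y.1} = ν Q

/-- The optimal partial transport distance `OT_{p,q}`, with the `q`-norm on the plane as ground
norm. -/
def OTDist (p : ℝ) (q : ℝ≥0∞) (μ ν : Measure HalfPlane) : ℝ≥0∞ :=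
  ⨅ (Γ : Measure (ClosedHalfPlane × ClosedHalfPlane)) (_ : IsAdmissiblePlan μ ν Γ),
    (∫⁻ z, ENNReal.ofReal (‖WithLp.toLp q (z.1.1 - z.2.1)‖ ^ p) ∂Γ) ^ (1 / p)

/-! ### Subsampling -/

section Subsampling

variable (𝕜 : Type*) [Field 𝕜] (k : ℕ) {m : ℕ} {X : Finset (EuclideanSpace ℝ (Fin m))}

/-- The persistence diagram of the subset of `X` formed by the points `s 0, …, s (n - 1)`. -/
def sampleDiagram {n : ℕ} (s : Fin n → X) : Measure HalfPlane :=
  persistenceDiagram 𝕜 k (Set.range fun i => (s i : EuclideanSpace ℝ (Fin m)))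

/-- The mean persistence measure of the diagrams of `B` subsamples. -/
def meanDiagram {n B : ℕ} (s : Fin B → Fin n → X) : Measure HalfPlane :=
  (B : ℝ≥0∞)⁻¹ • ∑ i, sampleDiagram 𝕜 k (s i)

/-- The expected persistence diagram of `n` independent points of `X` with law `π`. -/
def expectedDiagram (π : Measure X) (n : ℕ) : Measure HalfPlane :=
  (Measure.pi fun _ : Fin n => π).bind (sampleDiagram 𝕜 k)

lemma expectedDiagram_apply (π : Measure X) (n : ℕ) {A : Set HalfPlane} (hA : MeasurableSet A) :
    expectedDiagram 𝕜 k π n A =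
      ∫⁻ s, sampleDiagram 𝕜 k s A ∂(Measure.pi fun _ : Fin n => π) :=
  Measure.bind_apply hA (Measurable.of_discrete).aemeasurable

end Subsampling

end

/-!
The diagram of any subset of `X` is supported on the finitely many pairs of diameters of subsets of
`X`, because the Vietoris–Rips filtration does not change at any other scale, and its multiplicities
are at most `2 ^ #X`, the number of subsets of `X`. The mean diagram and the expected diagram are
therefore measures on one common finite set `F`. Keep their common mass in place and move the excess
at each `x ∈ F` vertically to the diagonal: this costs
`∑ x ∈ F, (x.2 - x.1) ^ p * |mean multiplicity of x - expected multiplicity of x|`. The mean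
multiplicity is an average of `B` pairwise independent variables with values in `[0, 2 ^ #X]`, so it
deviates from its expectation by at most `2 ^ #X / (2 √B)` in `L¹`.
-/

section Homology

variable (𝕜 : Type*) [Field 𝕜] {V : Type*} {K L M : PreAbstractSimplicialComplex V} (k : ℕ)

lemma finite_simplicialChains (hK : K.faces.Finite) : Module.Finite 𝕜 (simplicialChains 𝕜 K k) :=
  have : Finite {σ | σ ∈ K.faces ∧ σ.card = k + 1} := hK.subset fun _ hσ => hσ.1
  Module.Finite.equiv (Finsupp.supportedEquivFinsupp (R := 𝕜) (M := 𝕜) _).symm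

lemma finrank_simplicialChains_le (hK : K.faces.Finite) :
    Module.finrank 𝕜 (simplicialChains 𝕜 K k) ≤ K.faces.ncard := by
  set s : Set (Finset V) := {σ | σ ∈ K.faces ∧ σ.card = k + 1}
  have hs : s ⊆ K.faces := fun _ hσ => hσ.1
  have : Fintype s := (hK.subset hs).fintype
  calc Module.finrank 𝕜 (simplicialChains 𝕜 K k)
      = Module.finrank 𝕜 (s →₀ 𝕜) := (Finsupp.supportedEquivFinsupp s).finrank_eq
    _ = s.ncard := by rw [Module.finrank_finsupp_self, Set.ncard_eq_toFinset_card', s.toFinset_card]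
    _ ≤ K.faces.ncard := Set.ncard_le_ncard hs hK

variable [LinearOrder V]

lemma finite_simplicialCycles (hK : K.faces.Finite) : Module.Finite 𝕜 (simplicialCycles 𝕜 K k) :=
  have := finite_simplicialChains 𝕜 k hK
  have hle : simplicialCycles 𝕜 K k ≤ simplicialChains 𝕜 K k := inf_le_left
  Submodule.finiteDimensional_of_le hle

lemma finite_simplicialHomology (hK : K.faces.Finite) :
    Module.Finite 𝕜 (SimplicialHomology 𝕜 K k) :=
  have := finite_simplicialCycles 𝕜 k hK
  inferInstance

lemma finrank_simplicialHomology_le (hK : K.faces.Finite) :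
    Module.finrank 𝕜 (SimplicialHomology 𝕜 K k) ≤ K.faces.ncard :=
  have := finite_simplicialChains 𝕜 k hK
  have := finite_simplicialCycles 𝕜 k hK
  calc Module.finrank 𝕜 (SimplicialHomology 𝕜 K k)
      ≤ Module.finrank 𝕜 (simplicialCycles 𝕜 K k) := Submodule.finrank_quotient_le _
    _ ≤ Module.finrank 𝕜 (simplicialChains 𝕜 K k) := Submodule.finrank_mono inf_le_left
    _ ≤ K.faces.ncard := finrank_simplicialChains_le 𝕜 k hK

lemma simplicialHomologyMap_refl :
    simplicialHomologyMap 𝕜 (le_refl K) k = LinearMap.id :=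
  Submodule.mapQ_id _

lemma simplicialHomologyMap_comp (h : K ≤ L) (h' : L ≤ M) :
    simplicialHomologyMap 𝕜 h' k ∘ₗ simplicialHomologyMap 𝕜 h k =
      simplicialHomologyMap 𝕜 (h.trans h') k :=
  (Submodule.mapQ_comp _ _ _ _ _ _ _).symm

lemma simplicialHomologyMap_bijective_of_eq (h : K = L) :
    Function.Bijective (simplicialHomologyMap 𝕜 h.le k) := by
  subst h
  rw [simplicialHomologyMap_refl]
  exact Function.bijective_id

end Homology

section VietorisRips

lemma exists_disjoint_Icc_of_notMem {α : Type*} [LinearOrder α] [DenselyOrdered α]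
    (T : Finset α) {s u v : α} (hs : s ∉ T) (hu : u < s) (hv : s < v) :
    ∃ a b, u < a ∧ a < s ∧ s < b ∧ b < v ∧ Disjoint (T : Set α) (Set.Icc a b) := by
  have hu' : (insert u {r ∈ T | r < s}).max' (Finset.insert_nonempty _ _) < s :=
    (Finset.max'_lt_iff _ _).2 (by simpa using hu)
  have hv' : s < (insert v {r ∈ T | s < r}).min' (Finset.insert_nonempty _ _) :=
    (Finset.lt_min'_iff _ _).2 (by simpa using hv)
  obtain ⟨a, hlo, has⟩ := exists_between hu'
  obtain ⟨b, hsb, hhi⟩ := exists_between hv'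
  simp only [Finset.max'_lt_iff, Finset.lt_min'_iff, Finset.forall_mem_insert,
    Finset.mem_filter] at hlo hhi
  refine ⟨a, b, hlo.1, has, hsb, hhi.1, Set.disjoint_left.2 fun r hr hmem => ?_⟩
  rcases lt_or_gt_of_ne (ne_of_mem_of_not_mem hr hs) with hrs | hsr
  · exact (hlo.2 r ⟨hr, hrs⟩).not_ge hmem.1
  · exact (hhi.2 r ⟨hr, hsr⟩).not_ge hmem.2

variable {V : Type*} [PseudoMetricSpace V] {S : Set V} {X : Finset V}

lemma vietorisRips_faces_subset_powerset (hS : S ⊆ X) (ε : ℝ) :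
    (vietorisRips S ε).faces ⊆ X.powerset := fun _ hσ =>
  Finset.mem_powerset.2 (Finset.coe_subset.1 (hσ.2.1.trans hS))

lemma finite_vietorisRips_faces (hS : S ⊆ X) (ε : ℝ) : (vietorisRips S ε).faces.Finite :=
  X.powerset.finite_toSet.subset (vietorisRips_faces_subset_powerset hS ε)

lemma ncard_vietorisRips_faces_le (hS : S ⊆ X) (ε : ℝ) :
    (vietorisRips S ε).faces.ncard ≤ 2 ^ X.card := by
  rw [← Finset.card_powerset, ← Set.ncard_coe_finset]
  exact Set.ncard_le_ncard (vietorisRips_faces_subset_powerset hS ε) X.powerset.finite_toSet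

/-- The diameters of the subsets of `X`: the only scales at which the Vietoris–Rips filtration of a
subset of `X` can change. -/
noncomputable def criticalScales (X : Finset V) : Finset ℝ :=
  X.powerset.image fun σ : Finset V => Metric.diam (σ : Set V)

lemma vietorisRips_eq_of_disjoint_criticalScales (hS : S ⊆ X) {a b : ℝ} (hab : a ≤ b)
    (h : Disjoint (criticalScales X : Set ℝ) (Set.Icc a b)) :
    vietorisRips S a = vietorisRips S b := by
  refine le_antisymm (vietorisRips_mono S hab) fun σ hσ => ⟨hσ.1, hσ.2.1, ?_⟩
  have hdiam : Metric.diam (σ : Set V) ∈ criticalScales X :=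
    Finset.mem_image_of_mem _ (vietorisRips_faces_subset_powerset hS b hσ)
  by_contra! ha
  exact Set.disjoint_left.1 h hdiam ⟨ha, hσ.2.2.le⟩

lemma exists_vietorisRips_eq_of_notMem_criticalScales (hS : S ⊆ X) {s u v : ℝ}
    (hs : s ∉ criticalScales X) (hu : u < s) (hv : s < v) :
    ∃ a b, u < a ∧ a < s ∧ s < b ∧ b < v ∧ vietorisRips S a = vietorisRips S b := by
  obtain ⟨a, b, hua, has, hsb, hbv, hdisj⟩ := exists_disjoint_Icc_of_notMem _ hs hu hv
  exact ⟨a, b, hua, has, hsb, hbv,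
    vietorisRips_eq_of_disjoint_criticalScales hS (has.trans hsb).le hdisj⟩

/-- The points of the half-plane both of whose coordinates are critical scales of `X`: the only
points that can occur in the diagram of a subset of `X`. -/
noncomputable def criticalPairs (X : Finset V) : Finset HalfPlane :=
  (criticalScales X ×ˢ criticalScales X).subtype fun x => x.1 < x.2

lemma mem_criticalPairs {x : HalfPlane} :
    x ∈ criticalPairs X ↔ x.1.1 ∈ criticalScales X ∧ x.1.2 ∈ criticalScales X := by
  rw [criticalPairs, Finset.mem_subtype, Finset.mem_product]

end VietorisRips

section Diagram

attribute [local instance] euclideanLex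

variable (𝕜 : Type*) [Field 𝕜] {m : ℕ} (k : ℕ) {S : Set (EuclideanSpace ℝ (Fin m))}
  {X : Finset (EuclideanSpace ℝ (Fin m))}

section BirthDeathCount

variable {a b c d : ℝ} (hab : a ≤ b) (hbc : b ≤ c) (hcd : c ≤ d)

lemma birthDeathCount_le (hS : S ⊆ X) : birthDeathCount 𝕜 k S hab hbc hcd ≤ 2 ^ X.card :=
  have hfin := finite_vietorisRips_faces hS b
  have := finite_simplicialHomology 𝕜 k hfin
  calc birthDeathCount 𝕜 k S hab hbc hcd
      ≤ Module.finrank 𝕜 (deadClasses 𝕜 k S hab (hbc.trans hcd)) := Submodule.finrank_quotient_le _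
    _ ≤ Module.finrank 𝕜 (SimplicialHomology 𝕜 (vietorisRips S b) k) := Submodule.finrank_le _
    _ ≤ (vietorisRips S b).faces.ncard := finrank_simplicialHomology_le 𝕜 k hfin
    _ ≤ 2 ^ X.card := ncard_vietorisRips_faces_le hS b

lemma birthDeathCount_eq_zero_of_deadClasses_le
    (h : deadClasses 𝕜 k S hab (hbc.trans hcd) ≤ deadClasses 𝕜 k S hab hbc) :
    birthDeathCount 𝕜 k S hab hbc hcd = 0 :=
  have := Submodule.Quotient.subsingleton_iff.2 (Submodule.submoduleOf_eq_top.2 h)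
  Module.finrank_zero_of_subsingleton

lemma deadClasses_eq_top_of_eq {t : ℝ} (hbt : b ≤ t) (h : vietorisRips S a = vietorisRips S b) :
    deadClasses 𝕜 k S hab hbt = ⊤ := by
  rw [deadClasses,
    ← simplicialHomologyMap_comp 𝕜 k (vietorisRips_mono S hab) (vietorisRips_mono S hbt),
    LinearMap.range_comp_of_range_eq_top _
      (LinearMap.range_eq_top.2 (simplicialHomologyMap_bijective_of_eq 𝕜 k h).2)]
  exact top_unique (Submodule.map_le_iff_le_comap.1 LinearMap.map_le_range)

lemma deadClasses_trans_of_eq (h : vietorisRips S c = vietorisRips S d) :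
    deadClasses 𝕜 k S hab (hbc.trans hcd) = deadClasses 𝕜 k S hab hbc := by
  rw [deadClasses, deadClasses,
    ← simplicialHomologyMap_comp 𝕜 k (vietorisRips_mono S hbc) (vietorisRips_mono S hcd),
    ← simplicialHomologyMap_comp 𝕜 k (vietorisRips_mono S (hab.trans hbc))
      (vietorisRips_mono S hcd),
    LinearMap.range_comp, Submodule.comap_comp,
    Submodule.comap_map_eq_of_injective (simplicialHomologyMap_bijective_of_eq 𝕜 k h).1]

lemma birthDeathCount_eq_zero_of_birth_eq (h : vietorisRips S a = vietorisRips S b) :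
    birthDeathCount 𝕜 k S hab hbc hcd = 0 :=
  birthDeathCount_eq_zero_of_deadClasses_le 𝕜 k hab hbc hcd <|
    le_top.trans_eq (deadClasses_eq_top_of_eq 𝕜 k hab hbc h).symm

lemma birthDeathCount_eq_zero_of_death_eq (h : vietorisRips S c = vietorisRips S d) :
    birthDeathCount 𝕜 k S hab hbc hcd = 0 :=
  birthDeathCount_eq_zero_of_deadClasses_le 𝕜 k hab hbc hcd
    (deadClasses_trans_of_eq 𝕜 k hab hbc hcd h).le

lemma diagramMultiplicity_le_birthDeathCount {x : HalfPlane} (ha : a < x.1.1) (hb : x.1.1 < b)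
    (hc : c < x.1.2) (hd : x.1.2 < d) :
    diagramMultiplicity 𝕜 k S x ≤ birthDeathCount 𝕜 k S hab hbc hcd :=
  Nat.sInf_le ⟨a, b, c, d, hab, hbc, hcd, ha, hb, hc, hd, rfl⟩

end BirthDeathCount

lemma diagramMultiplicity_le (hS : S ⊆ X) (x : HalfPlane) :
    diagramMultiplicity 𝕜 k S x ≤ 2 ^ X.card := by
  obtain ⟨b, hb, hb'⟩ := exists_between x.2
  obtain ⟨c, hbc, hc⟩ := exists_between hb'
  exact (diagramMultiplicity_le_birthDeathCount 𝕜 k ((sub_one_lt _).trans hb).le hbc.le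
    (hc.trans (lt_add_one _)).le (sub_one_lt _) hb hc (lt_add_one _)).trans
    (birthDeathCount_le 𝕜 k _ _ _ hS)

lemma diagramMultiplicity_eq_zero_of_birth_notMem (hS : S ⊆ X) {x : HalfPlane}
    (hx : x.1.1 ∉ criticalScales X) : diagramMultiplicity 𝕜 k S x = 0 := by
  obtain ⟨c, hxc, hc⟩ := exists_between x.2
  obtain ⟨a, b, -, ha, hb, hbc, hab⟩ :=
    exists_vietorisRips_eq_of_notMem_criticalScales hS hx (sub_one_lt _) hxc
  have hle := diagramMultiplicity_le_birthDeathCount 𝕜 k (S := S) (ha.trans hb).le hbc.le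
    (hc.trans (lt_add_one _)).le ha hb hc (lt_add_one _)
  rwa [birthDeathCount_eq_zero_of_birth_eq 𝕜 k _ _ _ hab, Nat.le_zero] at hle

lemma diagramMultiplicity_eq_zero_of_death_notMem (hS : S ⊆ X) {x : HalfPlane}
    (hx : x.1.2 ∉ criticalScales X) : diagramMultiplicity 𝕜 k S x = 0 := by
  obtain ⟨b, hb, hbx⟩ := exists_between x.2
  obtain ⟨c, d, hbc, hc, hd, -, hcd⟩ :=
    exists_vietorisRips_eq_of_notMem_criticalScales hS hx hbx (lt_add_one _)
  have hle := diagramMultiplicity_le_birthDeathCount 𝕜 k (S := S) ((sub_one_lt _).trans hb).le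
    hbc.le (hc.trans hd).le (sub_one_lt _) hb hc hd
  rwa [birthDeathCount_eq_zero_of_death_eq 𝕜 k _ _ _ hcd, Nat.le_zero] at hle

lemma persistenceDiagram_eq_sum (hS : S ⊆ X) :
    persistenceDiagram 𝕜 k S =
      ∑ x ∈ criticalPairs X, (diagramMultiplicity 𝕜 k S x : ℝ≥0∞) • Measure.dirac x := by
  have hzero (x : HalfPlane) (hx : x ∉ criticalPairs X) : diagramMultiplicity 𝕜 k S x = 0 := by
    rcases not_and_or.1 (mem_criticalPairs.not.1 hx) with h | h
    · exact diagramMultiplicity_eq_zero_of_birth_notMem 𝕜 k hS h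
    · exact diagramMultiplicity_eq_zero_of_death_notMem 𝕜 k hS h
  ext A hA
  rw [persistenceDiagram, Measure.sum_apply _ hA, Measure.finsetSum_apply]
  exact tsum_eq_sum fun x hx => by simp [hzero x hx]

end Diagram

section Transport

/-- The inclusion of the open half-plane into the closed one. -/
def HalfPlane.toClosed (x : HalfPlane) : ClosedHalfPlane := ⟨x.1, x.2.le⟩

/-- The vertical projection of the half-plane to the diagonal. Vertical displacements have the same
length in every `q`-norm. -/
def HalfPlane.toDiagonal (x : HalfPlane) : ClosedHalfPlane := ⟨(x.1.1, x.1.1), le_rfl⟩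

/-- The persistence (lifetime) of a birth–death pair, which is its vertical distance to the
diagonal. -/
def HalfPlane.persistence (x : HalfPlane) : ℝ := x.1.2 - x.1.1

lemma HalfPlane.persistence_pos (x : HalfPlane) : 0 < x.persistence := sub_pos.2 x.2

@[fun_prop]
lemma HalfPlane.measurable_toClosed : Measurable HalfPlane.toClosed :=
  measurable_subtype_coe.subtype_mk

@[fun_prop]
lemma HalfPlane.measurable_toDiagonal : Measurable HalfPlane.toDiagonal :=
  Measurable.subtype_mk (by fun_prop)

@[simp]
lemma HalfPlane.exists_mem_toClosed_eq_iff {x : HalfPlane} {A : Set HalfPlane} :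
    (∃ y ∈ A, x.toClosed.1 = y.1) ↔ x ∈ A :=
  ⟨fun ⟨y, hy, hxy⟩ => (Subtype.ext hxy : x = y) ▸ hy, fun hx => ⟨x, hx, rfl⟩⟩

@[simp]
lemma HalfPlane.not_exists_mem_toDiagonal_eq (x : HalfPlane) (A : Set HalfPlane) :
    ¬ ∃ y ∈ A, x.toDiagonal.1 = y.1 := by
  rintro ⟨y, -, hxy⟩
  exact y.2.ne (hxy ▸ rfl)

lemma ClosedHalfPlane.measurableSet_exists_mem_eq {A : Set HalfPlane} (hA : MeasurableSet A) :
    MeasurableSet {z : ClosedHalfPlane | ∃ y ∈ A, z.1 = y.1} := by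
  have hΩ : MeasurableSet {x : ℝ × ℝ | x.1 < x.2} := measurableSet_lt measurable_fst measurable_snd
  convert measurable_subtype_coe (MeasurableSet.subtype_image hΩ hA) using 1
  ext z
  simp [eq_comm]

instance ClosedHalfPlane.sigmaCompactSpace : SigmaCompactSpace ClosedHalfPlane :=
  (isClosed_le continuous_fst continuous_snd).isClosedEmbedding_subtypeVal.sigmaCompactSpace

/-- The transport plan from `ρ + α` to `ρ + β` that leaves the mass of `ρ` in place, sends the mass
of `α` vertically to the diagonal and brings the mass of `β` vertically from the diagonal. -/
noncomputable def diagonalPlan (ρ α β : Measure HalfPlane) :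
    Measure (ClosedHalfPlane × ClosedHalfPlane) :=
  ρ.map (fun x => (x.toClosed, x.toClosed)) + α.map (fun x => (x.toClosed, x.toDiagonal)) +
    β.map (fun x => (x.toDiagonal, x.toClosed))

lemma isAdmissiblePlan_diagonalPlan (ρ α β : Measure HalfPlane) [IsFiniteMeasure ρ]
    [IsFiniteMeasure α] [IsFiniteMeasure β] :
    IsAdmissiblePlan (ρ + α) (ρ + β) (diagonalPlan ρ α β) where
  radon := by
    unfold diagonalPlan
    infer_instance
  fst_eq A hA := by
    have hmeas : MeasurableSet {z : ClosedHalfPlane × ClosedHalfPlane | ∃ x ∈ A, z.1.1 = x.1} :=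
      measurable_fst (ClosedHalfPlane.measurableSet_exists_mem_eq hA)
    simp only [diagonalPlan, Measure.add_apply]
    iterate 3 rw [Measure.map_apply (by fun_prop) hmeas]
    simp [-Subtype.exists]
  snd_eq A hA := by
    have hmeas : MeasurableSet {z : ClosedHalfPlane × ClosedHalfPlane | ∃ x ∈ A, z.2.1 = x.1} :=
      measurable_snd (ClosedHalfPlane.measurableSet_exists_mem_eq hA)
    simp only [diagonalPlan, Measure.add_apply]
    iterate 3 rw [Measure.map_apply (by fun_prop) hmeas]
    simp [-Subtype.exists]

lemma norm_toLp_zero_prod {E F : Type*} [SeminormedAddCommGroup E] [SeminormedAddCommGroup F]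
    {q : ℝ≥0∞} (hq : q ≠ 0) (y : F) : ‖WithLp.toLp q ((0 : E), y)‖ = ‖y‖ := by
  by_cases hq' : q = ∞
  · subst hq'
    simp
  · have hpos := ENNReal.toReal_pos hq hq'
    simp [WithLp.prod_norm_eq_add hpos, Real.zero_rpow hpos.ne', ← Real.rpow_mul, hpos.ne']

lemma HalfPlane.norm_toClosed_sub_toDiagonal {q : ℝ≥0∞} (hq : q ≠ 0) (x : HalfPlane) :
    ‖WithLp.toLp q (x.toClosed.1 - x.toDiagonal.1)‖ = x.persistence := by
  have h : x.toClosed.1 - x.toDiagonal.1 = (0, x.persistence) := by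
    simp [toClosed, toDiagonal, persistence, Prod.ext_iff]
  rw [h, norm_toLp_zero_prod hq, Real.norm_of_nonneg x.persistence_pos.le]

lemma HalfPlane.norm_toDiagonal_sub_toClosed {q : ℝ≥0∞} (hq : q ≠ 0) (x : HalfPlane) :
    ‖WithLp.toLp q (x.toDiagonal.1 - x.toClosed.1)‖ = x.persistence := by
  have h : x.toDiagonal.1 - x.toClosed.1 = (0, -x.persistence) := by
    simp [toClosed, toDiagonal, persistence, Prod.ext_iff]
  rw [h, norm_toLp_zero_prod hq, norm_neg, Real.norm_of_nonneg x.persistence_pos.le]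

variable {p : ℝ} {q : ℝ≥0∞}

lemma OTDist_add_add_rpow_le (hp : 0 < p) (hq : q ≠ 0) (ρ α β : Measure HalfPlane)
    [IsFiniteMeasure ρ] [IsFiniteMeasure α] [IsFiniteMeasure β] :
    OTDist p q (ρ + α) (ρ + β) ^ p ≤ ∫⁻ x, ENNReal.ofReal (x.persistence ^ p) ∂(α + β) := by
  set cost : ClosedHalfPlane × ClosedHalfPlane → ℝ≥0∞ :=
    fun z => ENNReal.ofReal (‖WithLp.toLp q (z.1.1 - z.2.1)‖ ^ p)
  have hstay (x : HalfPlane) : cost (x.toClosed, x.toClosed) = 0 := by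
    have hnorm : ‖WithLp.toLp q ((0 : ℝ), (0 : ℝ))‖ = 0 := by rw [norm_toLp_zero_prod hq, norm_zero]
    simp only [cost, sub_self, Prod.zero_eq_mk, hnorm, Real.zero_rpow hp.ne', ENNReal.ofReal_zero]
  calc OTDist p q (ρ + α) (ρ + β) ^ p
      ≤ ((∫⁻ z, cost z ∂diagonalPlan ρ α β) ^ (1 / p)) ^ p := by
        gcongr
        exact iInf₂_le _ (isAdmissiblePlan_diagonalPlan ρ α β)
    _ = ∫⁻ z, cost z ∂diagonalPlan ρ α β := by
        rw [one_div, ENNReal.rpow_inv_rpow hp.ne']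
    _ ≤ ∫⁻ x, cost (x.toClosed, x.toClosed) ∂ρ + ∫⁻ x, cost (x.toClosed, x.toDiagonal) ∂α +
          ∫⁻ x, cost (x.toDiagonal, x.toClosed) ∂β := by
        rw [diagonalPlan, lintegral_add_measure, lintegral_add_measure]
        gcongr <;> exact lintegral_map_le _ _
    _ = ∫⁻ x, ENNReal.ofReal (x.persistence ^ p) ∂(α + β) := by
        simp only [hstay, lintegral_zero, zero_add, cost,
          HalfPlane.norm_toClosed_sub_toDiagonal hq, HalfPlane.norm_toDiagonal_sub_toClosed hq,
          lintegral_add_measure]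

lemma ofReal_min_add_ofReal_sub {a b : ℝ} (hb : 0 ≤ b) :
    ENNReal.ofReal (min a b) + ENNReal.ofReal (a - b) = ENNReal.ofReal a := by
  rcases le_total a b with h | h
  · rw [min_eq_left h, ENNReal.ofReal_of_nonpos (sub_nonpos.2 h), add_zero]
  · rw [min_eq_right h, ← ENNReal.ofReal_add hb (sub_nonneg.2 h), add_sub_cancel]

lemma ofReal_sub_add_ofReal_sub (a b : ℝ) :
    ENNReal.ofReal (a - b) + ENNReal.ofReal (b - a) = ENNReal.ofReal |a - b| := by
  rcases le_total a b with h | h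
  · rw [ENNReal.ofReal_of_nonpos (sub_nonpos.2 h), zero_add, abs_sub_comm,
      abs_of_nonneg (sub_nonneg.2 h)]
  · rw [ENNReal.ofReal_of_nonpos (sub_nonpos.2 h), add_zero, abs_of_nonneg (sub_nonneg.2 h)]

lemma OTDist_sum_smul_dirac_rpow_le (hp : 0 < p) (hq : q ≠ 0) (F : Finset HalfPlane)
    {a b : HalfPlane → ℝ} (ha : 0 ≤ a) (hb : 0 ≤ b) :
    OTDist p q (∑ x ∈ F, ENNReal.ofReal (a x) • Measure.dirac x)
        (∑ x ∈ F, ENNReal.ofReal (b x) • Measure.dirac x) ^ p ≤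
      ∑ x ∈ F, ENNReal.ofReal (x.persistence ^ p) * ENNReal.ofReal |a x - b x| := by
  let atomic (c : HalfPlane → ℝ) : Measure HalfPlane :=
    ∑ x ∈ F, ENNReal.ofReal (c x) • Measure.dirac x
  have hfin (c : HalfPlane → ℝ) : IsFiniteMeasure (atomic c) :=
    ⟨by simp [atomic, ENNReal.sum_lt_top]⟩
  have hsplit {c d : HalfPlane → ℝ} (hd : 0 ≤ d) :
      atomic c = atomic (fun x => min (c x) (d x)) + atomic (fun x => c x - d x) := by
    simp only [atomic, ← Finset.sum_add_distrib, ← add_smul, ofReal_min_add_ofReal_sub (hd _)]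
  have hcommon : atomic (fun x => min (b x) (a x)) = atomic (fun x => min (a x) (b x)) := by
    simp only [min_comm]
  calc OTDist p q (atomic a) (atomic b) ^ p
      ≤ ∫⁻ x, ENNReal.ofReal (x.persistence ^ p)
          ∂(atomic (fun x => a x - b x) + atomic (fun x => b x - a x)) := by
        rw [hsplit (c := a) hb, hsplit (c := b) ha, hcommon]
        exact OTDist_add_add_rpow_le hp hq _ _ _
    _ = ∑ x ∈ F, ENNReal.ofReal (x.persistence ^ p) * ENNReal.ofReal |a x - b x| := by
        simp only [atomic, ← Finset.sum_add_distrib, ← add_smul, ofReal_sub_add_ofReal_sub,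
          lintegral_finsetSum_measure, lintegral_smul_measure, lintegral_dirac, smul_eq_mul,
          mul_comm]

end Transport

section MeanDeviation

variable {Ω ι : Type*} [MeasurableSpace Ω] {P : Measure Ω}

lemma integral_abs_sub_integral_le_sqrt_variance [IsProbabilityMeasure P] {Y : Ω → ℝ}
    (hY : MemLp Y 2 P) : ∫ ω, |Y ω - P[Y]| ∂P ≤ √Var[Y; P] := by
  refine Real.le_sqrt_of_sq_le (sub_nonneg.1 ?_)
  have hdev : MemLp (fun ω => |Y ω - P[Y]|) 2 P := (hY.sub (memLp_const _)).abs
  calc 0 ≤ Var[fun ω => |Y ω - P[Y]|; P] := variance_nonneg _ _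
    _ = Var[Y; P] - (∫ ω, |Y ω - P[Y]| ∂P) ^ 2 := by
      rw [variance_eq_sub hdev, variance_eq_integral hY.aemeasurable]
      simp only [Pi.pow_apply, sq_abs]

variable [Fintype ι] {Y : ι → Ω → ℝ}

lemma variance_mean_le {v : ℝ} (hY : ∀ i, MemLp (Y i) 2 P)
    (hindep : Pairwise fun i j => Y i ⟂ᵢ[P] Y j) (hvar : ∀ i, Var[Y i; P] ≤ v) :
    Var[fun ω => (Fintype.card ι : ℝ)⁻¹ * ∑ i, Y i ω; P] ≤ v / Fintype.card ι := by
  have hsum : Var[fun ω => ∑ i, Y i ω; P] = ∑ i, Var[Y i; P] := by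
    simpa only [Finset.sum_fn] using
      IndepFun.variance_sum (fun i _ => hY i) fun i _ j _ hij => hindep hij
  calc Var[fun ω => (Fintype.card ι : ℝ)⁻¹ * ∑ i, Y i ω; P]
      = (Fintype.card ι : ℝ)⁻¹ ^ 2 * ∑ i, Var[Y i; P] := by rw [variance_const_mul, hsum]
    _ ≤ (Fintype.card ι : ℝ)⁻¹ ^ 2 * ∑ _i : ι, v := by gcongr with i; exact hvar i
    _ = v / Fintype.card ι := by
      rw [Finset.sum_const, Finset.card_univ, nsmul_eq_mul]
      field_simp

lemma lintegral_abs_mean_sub_le [IsProbabilityMeasure P] [Nonempty ι] {v e : ℝ}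
    (hY : ∀ i, MemLp (Y i) 2 P) (hindep : Pairwise fun i j => Y i ⟂ᵢ[P] Y j)
    (hvar : ∀ i, Var[Y i; P] ≤ v) (hmean : ∀ i, P[Y i] = e) :
    ∫⁻ ω, ENNReal.ofReal |(Fintype.card ι : ℝ)⁻¹ * ∑ i, Y i ω - e| ∂P ≤
      ENNReal.ofReal √(v / Fintype.card ι) := by
  set Z : Ω → ℝ := fun ω => (Fintype.card ι : ℝ)⁻¹ * ∑ i, Y i ω
  have hZ : MemLp Z 2 P := (memLp_finsetSum _ fun i _ => hY i).const_mul _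
  have hZmean : P[Z] = e := by
    rw [integral_const_mul, integral_finsetSum _ fun i _ => (hY i).integrable one_le_two]
    simp [hmean]
  have hint : Integrable (fun ω => |Z ω - e|) P :=
    ((hZ.integrable one_le_two).sub (integrable_const e)).abs
  rw [← ofReal_integral_eq_lintegral_ofReal hint (ae_of_all _ fun _ => abs_nonneg _)]
  refine ENNReal.ofReal_le_ofReal ?_
  calc ∫ ω, |Z ω - e| ∂P ≤ √Var[Z; P] := hZmean ▸ integral_abs_sub_integral_le_sqrt_variance hZ
    _ ≤ √(v / Fintype.card ι) := Real.sqrt_le_sqrt (variance_mean_le hY hindep hvar)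

end MeanDeviation

section Subsampling

variable (𝕜 : Type*) [Field 𝕜] (k : ℕ) {m n B : ℕ} {X : Finset (EuclideanSpace ℝ (Fin m))}

/-- The multiplicity of `x` in the diagram of the sample `s`. -/
noncomputable def sampleMultiplicity (s : Fin n → X) (x : HalfPlane) : ℕ :=
  diagramMultiplicity 𝕜 k (Set.range fun i => (s i : EuclideanSpace ℝ (Fin m))) x

/-- The mass of `x` in the mean diagram of the samples `s 0, …, s (B - 1)`. -/
noncomputable def meanMultiplicity (s : Fin B → Fin n → X) (x : HalfPlane) : ℝ :=
  (B : ℝ)⁻¹ * ∑ i, (sampleMultiplicity 𝕜 k (s i) x : ℝ)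

/-- The mass of `x` in the expected diagram of a sample with law `ν`. -/
noncomputable def expectedMultiplicity (ν : Measure (Fin n → X)) (x : HalfPlane) : ℝ :=
  ∫ s, (sampleMultiplicity 𝕜 k s x : ℝ) ∂ν

lemma meanMultiplicity_nonneg (s : Fin B → Fin n → X) : 0 ≤ meanMultiplicity 𝕜 k s :=
  fun _ => by unfold meanMultiplicity; positivity

lemma expectedMultiplicity_nonneg (ν : Measure (Fin n → X)) : 0 ≤ expectedMultiplicity 𝕜 k ν :=
  fun _ => integral_nonneg fun _ => Nat.cast_nonneg _

lemma range_sample_subset (s : Fin n → X) :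
    (Set.range fun i => (s i : EuclideanSpace ℝ (Fin m))) ⊆ X :=
  Set.range_subset_iff.2 fun i => (s i).2

lemma sampleMultiplicity_mem_Icc (s : Fin n → X) (x : HalfPlane) :
    (sampleMultiplicity 𝕜 k s x : ℝ) ∈ Set.Icc (0 : ℝ) (2 ^ X.card) :=
  ⟨Nat.cast_nonneg _, mod_cast diagramMultiplicity_le 𝕜 k (range_sample_subset s) x⟩

lemma sampleDiagram_eq_sum (s : Fin n → X) :
    sampleDiagram 𝕜 k s =
      ∑ x ∈ criticalPairs X, (sampleMultiplicity 𝕜 k s x : ℝ≥0∞) • Measure.dirac x :=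
  persistenceDiagram_eq_sum 𝕜 k (range_sample_subset s)

lemma meanDiagram_eq_sum (hB : 0 < B) (s : Fin B → Fin n → X) :
    meanDiagram 𝕜 k s =
      ∑ x ∈ criticalPairs X, ENNReal.ofReal (meanMultiplicity 𝕜 k s x) • Measure.dirac x := by
  simp only [meanDiagram, sampleDiagram_eq_sum]
  rw [Finset.sum_comm, Finset.smul_sum]
  refine Finset.sum_congr rfl fun x _ => ?_
  rw [← Finset.sum_smul, smul_smul, meanMultiplicity, ENNReal.ofReal_mul (by positivity),
    ENNReal.ofReal_inv_of_pos (Nat.cast_pos.2 hB), ENNReal.ofReal_natCast,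
    ENNReal.ofReal_sum_of_nonneg fun i _ => Nat.cast_nonneg _]
  simp only [ENNReal.ofReal_natCast]

lemma bind_sampleDiagram_eq_sum (ν : Measure (Fin n → X)) [IsFiniteMeasure ν] :
    ν.bind (sampleDiagram 𝕜 k) =
      ∑ x ∈ criticalPairs X, ENNReal.ofReal (expectedMultiplicity 𝕜 k ν x) • Measure.dirac x := by
  ext A hA
  rw [Measure.bind_apply hA Measurable.of_discrete.aemeasurable, Measure.finsetSum_apply]
  simp only [sampleDiagram_eq_sum, Measure.finsetSum_apply, Measure.smul_apply, smul_eq_mul]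
  rw [lintegral_finsetSum _ fun _ _ => Measurable.of_discrete]
  refine Finset.sum_congr rfl fun x _ => ?_
  rw [lintegral_mul_const _ Measurable.of_discrete, expectedMultiplicity,
    ofReal_integral_eq_lintegral_ofReal Integrable.of_finite
      (ae_of_all _ fun s => Nat.cast_nonneg _)]
  simp only [ENNReal.ofReal_natCast]

lemma OTDist_meanDiagram_bind_rpow_le {p : ℝ} {q : ℝ≥0∞} (hp : 0 < p) (hq : q ≠ 0) (hB : 0 < B)
    (ν : Measure (Fin n → X)) [IsFiniteMeasure ν] (s : Fin B → Fin n → X) :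
    OTDist p q (meanDiagram 𝕜 k s) (ν.bind (sampleDiagram 𝕜 k)) ^ p ≤
      ∑ x ∈ criticalPairs X, ENNReal.ofReal (x.persistence ^ p) *
        ENNReal.ofReal |meanMultiplicity 𝕜 k s x - expectedMultiplicity 𝕜 k ν x| := by
  rw [meanDiagram_eq_sum 𝕜 k hB, bind_sampleDiagram_eq_sum]
  exact OTDist_sum_smul_dirac_rpow_le hp hq _ (meanMultiplicity_nonneg 𝕜 k s)
    (expectedMultiplicity_nonneg 𝕜 k ν)

variable {Ω : Type*} [MeasurableSpace Ω] {P : Measure Ω} {ν : Measure (Fin n → X)}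
  {S : Fin B → Ω → Fin n → X}

lemma aemeasurable_meanMultiplicity (hS : ∀ i, AEMeasurable (S i) P) (x : HalfPlane) :
    AEMeasurable (fun ω => meanMultiplicity 𝕜 k (fun i => S i ω) x) P :=
  have hmult : Measurable fun s : Fin n → X => (sampleMultiplicity 𝕜 k s x : ℝ) :=
    Measurable.of_discrete
  (Finset.univ.aemeasurable_fun_sum fun i _ => hmult.comp_aemeasurable (hS i)).const_mul _

lemma lintegral_abs_meanMultiplicity_sub_le [IsProbabilityMeasure P] (hB : 0 < B)
    (hlaw : ∀ i, HasLaw (S i) ν P) (hindep : Pairwise fun i j => S i ⟂ᵢ[P] S j) (x : HalfPlane) :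
    ∫⁻ ω, ENNReal.ofReal
        |meanMultiplicity 𝕜 k (fun i => S i ω) x - expectedMultiplicity 𝕜 k ν x| ∂P ≤
      ENNReal.ofReal (2 ^ X.card / 2 / √B) := by
  have : NeZero B := ⟨hB.ne'⟩
  let mult (s : Fin n → X) : ℝ := sampleMultiplicity 𝕜 k s x
  have hmult : Measurable mult := Measurable.of_discrete
  have hmeas (i) : AEMeasurable (mult ∘ S i) P := hmult.comp_aemeasurable (hlaw i).aemeasurable
  have hbound (i) : ∀ᵐ ω ∂P, mult (S i ω) ∈ Set.Icc (0 : ℝ) (2 ^ X.card) :=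
    ae_of_all _ fun ω => sampleMultiplicity_mem_Icc 𝕜 k (S i ω) x
  have hdev := lintegral_abs_mean_sub_le (P := P) (Y := fun i => mult ∘ S i)
    (fun i => memLp_of_bounded (hbound i) (hmeas i).aestronglyMeasurable 2)
    (fun i j hij => (hindep hij).comp hmult hmult)
    (fun i => variance_le_sq_of_bounded (hbound i) (hmeas i))
    (fun i => (hlaw i).integral_comp hmult.aestronglyMeasurable)
  rwa [Fintype.card_fin, sub_zero, Real.sqrt_div (sq_nonneg _),
    Real.sqrt_sq (by positivity)] at hdev

end Subsampling

theorem mainTheorem4_general {m : ℕ} (X : Finset (EuclideanSpace ℝ (Fin m))) (p : ℝ) (hp : 0 < p) :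
    ∃ C : ℝ, 0 < C ∧
      ∀ (q : ℝ≥0∞), q ≠ 0 → ∀ (𝕜 : Type*) [Field 𝕜] (k n B : ℕ), 0 < B →
        ∀ (ν : Measure (Fin n → X)) [IsProbabilityMeasure ν]
          (Ω : Type*) [MeasurableSpace Ω] (P : Measure Ω) [IsProbabilityMeasure P]
          (S : Fin B → Ω → Fin n → X),
          (∀ i, HasLaw (S i) ν P) → (Pairwise fun i j => S i ⟂ᵢ[P] S j) →
          ∫⁻ ω, OTDist p q (meanDiagram 𝕜 k fun i => S i ω) (ν.bind (sampleDiagram 𝕜 k)) ^ p ∂P ≤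
            ENNReal.ofReal (C / √B) := by
  set A : ℝ := ∑ x ∈ criticalPairs X, x.persistence ^ p
  set N : ℝ := 2 ^ X.card
  have hpers (x : HalfPlane) : 0 ≤ x.persistence ^ p := Real.rpow_nonneg x.persistence_pos.le _
  have hA : 0 ≤ A := Finset.sum_nonneg fun x _ => hpers x
  refine ⟨A * (N / 2) + 1, by positivity, fun q hq 𝕜 _ k n B hB ν _ Ω _ P _ S hlaw hindep => ?_⟩
  set dev : HalfPlane → Ω → ℝ≥0∞ := fun x ω => ENNReal.ofReal
    |meanMultiplicity 𝕜 k (fun i => S i ω) x - expectedMultiplicity 𝕜 k ν x|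
  have hdev (x : HalfPlane) : AEMeasurable (dev x) P := by
    have := aemeasurable_meanMultiplicity 𝕜 k (fun i => (hlaw i).aemeasurable) x
    fun_prop
  calc _ ≤ ∫⁻ ω, ∑ x ∈ criticalPairs X, ENNReal.ofReal (x.persistence ^ p) * dev x ω ∂P :=
        lintegral_mono fun ω => OTDist_meanDiagram_bind_rpow_le 𝕜 k hp hq hB ν _
    _ = ∑ x ∈ criticalPairs X, ENNReal.ofReal (x.persistence ^ p) * ∫⁻ ω, dev x ω ∂P := by
        rw [lintegral_finsetSum' _ fun x _ => (hdev x).const_mul _]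
        exact Finset.sum_congr rfl fun x _ => lintegral_const_mul'' _ (hdev x)
    _ ≤ ∑ x ∈ criticalPairs X, ENNReal.ofReal (x.persistence ^ p) *
          ENNReal.ofReal (N / 2 / √B) := by
        gcongr with x
        exact lintegral_abs_meanMultiplicity_sub_le 𝕜 k hB hlaw hindep x
    _ = ENNReal.ofReal (A * (N / 2) / √B) := by
        rw [← Finset.sum_mul, ← ENNReal.ofReal_sum_of_nonneg fun x _ => hpers x,
          ← ENNReal.ofReal_mul hA, mul_div_assoc]
    _ ≤ ENNReal.ofReal ((A * (N / 2) + 1) / √B) := by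
        gcongr
        exact le_add_of_nonneg_right zero_le_one

theorem mainTheorem4 {m : ℕ} (X : Finset (EuclideanSpace ℝ (Fin m))) (p : ℝ) (hp : 1 ≤ p) :
    ∃ C : ℝ, 0 < C ∧
      ∀ (𝕜 : Type*) [Field 𝕜] (k : ℕ) (π : Measure X) [IsProbabilityMeasure π] (n B : ℕ),
        0 < n → 0 < B →
        ∀ (Ω : Type*) [MeasurableSpace Ω] (P : Measure Ω) [IsProbabilityMeasure P]
          (S : Fin B → Ω → Fin n → X),
          (∀ i, HasLaw (S i) (Measure.pi fun _ : Fin n => π) P) → iIndepFun S P →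
          ∫⁻ ω, OTDist p (ENNReal.ofReal p) (meanDiagram 𝕜 k fun i => S i ω)
              (expectedDiagram 𝕜 k π n) ^ p ∂P ≤ ENNReal.ofReal (C / √B) := by
  obtain ⟨C, hC, hbound⟩ := mainTheorem4_general X p (one_pos.trans_le hp)
  exact ⟨C, hC, fun 𝕜 _ k π _ n B _ hB Ω _ P _ S hlaw hindep =>
    hbound _ (ENNReal.ofReal_pos.2 (one_pos.trans_le hp)).ne' 𝕜 k n B hB _ Ω P S hlaw
      fun _ _ hij => hindep.indepFun hij⟩
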